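/- Let $N,M\ge 1$ be integers, $\sigma>0$, $\rho\in\mathbb{R}$ with $|\rho|<1$, $P,\eta_0>0$, and $\gamma_{th}\ge 0$. Let $x_{0n},y_{0n},x_{mn},y_{mn}$ ($1\le n\le N$, $2\le m\le M$) be mutually independent centred real Gaussian random variables of variance $1/2$, and consider the equally correlated Rayleigh fading channel of a MISO system with $N$ transmit antennas and a fluid antenna with $M$ ports, $$h_{1n}=\sigma x_{0n}+j\sigma y_{0n},\qquad h_{mn}=\sigma\big(\sqrt{1-\rho^2}\,x_{mn}+\rho x_{0n}\big)+j\sigma\big(\sqrt{1-\rho^2}\,y_{mn}+\rho y_{0n}\big)\quad(2\le m\le M).$$ Let $X_m=\sum_{n=1}^N|h_{mn}|^2$ be the precoding gain at port $m$, let $X_{\rm FAS}=\max\{X_1,\dots,X_M\}$, and let $P_{\rm out}(\gamma_{th})=\Pr(X_{\rm FAS}<\gamma_{th})$ be the outage probability. Write $\gamma(N,x)=\int_0^x t^{N-1}e^{-t}\,dt$ for the lower incomplete gamma function. Then $$P_{\rm out}(\gamma_{th})\le\frac{1}{(N-1)!}\,\gamma\!\left(N,\frac{\gamma_{th}}{\sigma^2}\right)\left(1-e^{-\frac{2\gamma_{th}}{\sigma^2(1-\rho^2)}}\right)^{M-1}.$$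 If $\sigma^2\ge 1$ (in particular for the normalization $\sigma^2=1$), then also $$P_{\rm out}(\gamma_{th})\le\frac{1}{(N-1)!}\,\gamma(N,\gamma_{th})\left(1-e^{-\frac{2\gamma_{th}}{\sigma^2(1-\rho^2)}}\right)^{M-1}.$$ Moreover, let $\gamma_m=P|\mathbf{w}_m\mathbf{h}_m|^2/\eta_0^2$ be the received SNR at port $m$ under maximum-ratio transmission, where $\mathbf{h}_m=(h_{m1},\dots,h_{mN})^T$ and $\mathbf{w}_m=\mathbf{h}_m^H/\|\mathbf{h}_m\|$, let $\gamma_{\rm FAS}=\max\{\gamma_1,\dots,\gamma_M\}$, and let $\bar\gamma=P\,\mathbb{E}[|h_{mn}|^2]/\eta_0^2$ be the average single-branch SNR (computed on any branch $(m,n)$). Then the outage probability expressed through the normalized SNR satisfies, for every $\sigma>0$, $$\Pr\!\left(\frac{\gamma_{\rm FAS}}{\bar\gamma}<\gamma_{th}\right)\le\frac{1}{(N-1)!}\,\gamma(N,\gamma_{th})\left(1-e^{-\frac{2\gamma_{th}}{1-\rho^2}}\right)^{M-1}.$$ -/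

import Mathlib

open MeasureTheory ProbabilityTheory
open scoped NNReal

noncomputable section

/-- The lower incomplete gamma function `γ(s, x) = ∫₀ˣ t^(s-1) e^(-t) dt`. -/
def lowerIncompleteGamma (s x : ℝ) : ℝ :=
  ∫ t in (0 : ℝ)..x, t ^ (s - 1) * Real.exp (-t)

/-- The Gaussian variables `x_{mn}, y_{mn}` which drive the channel: centred, of variance `1/2`,
and mutually independent. Ports are numbered from `0`, so the row of index `0` holds the variables
shared by all the ports. -/
structure IsChannelNoise {Ω : Type*} [MeasurableSpace Ω] (μ : Measure Ω) {M N : ℕ}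
    (x y : Fin M → Fin N → Ω → ℝ) : Prop where
  law_x : ∀ m n, HasLaw (x m n) (gaussianReal 0 (1 / 2)) μ
  law_y : ∀ m n, HasLaw (y m n) (gaussianReal 0 (1 / 2)) μ
  indep : iIndepFun
    (Sum.elim (fun p : Fin M × Fin N => x p.1 p.2) (fun p : Fin M × Fin N => y p.1 p.2)) μ

/-- The equally correlated Rayleigh channel. The coefficient of the reference port is
`σ (x_{0n} + i y_{0n})`, that of any other port `m` is
`σ (√(1-ρ²) x_{mn} + ρ x_{0n}) + i σ (√(1-ρ²) y_{mn} + ρ y_{0n})`. -/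
def channel {Ω : Type*} {M N : ℕ} (hM : 0 < M) (σ ρ : ℝ) (x y : Fin M → Fin N → Ω → ℝ)
    (m : Fin M) (n : Fin N) (ω : Ω) : ℂ :=
  if (m : ℕ) = 0 then
    ⟨σ * x m n ω, σ * y m n ω⟩
  else
    ⟨σ * (√(1 - ρ ^ 2) * x m n ω + ρ * x ⟨0, hM⟩ n ω),
     σ * (√(1 - ρ ^ 2) * y m n ω + ρ * y ⟨0, hM⟩ n ω)⟩

/-- The precoding gain `X_m = ∑ₙ |h_{mn}|²`. -/
def precodingGain {Ω : Type*} {M N : ℕ} (h : Fin M → Fin N → Ω → ℂ) (m : Fin M) (ω : Ω) : ℝ :=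
  ∑ n, ‖h m n ω‖ ^ 2

/-- The precoding gain of the selected port, `X_FAS = max {X_1, …, X_M}`. -/
def fasGain {Ω : Type*} {M N : ℕ} (h : Fin M → Fin N → Ω → ℂ) (ω : Ω) : ℝ :=
  ⨆ m, precodingGain h m ω

/-- The maximum-ratio transmission precoder `w_m = h_mᴴ / ‖h_m‖`, with the Euclidean norm. -/
def mrtPrecoder {Ω : Type*} {M N : ℕ} (h : Fin M → Fin N → Ω → ℂ) (m : Fin M) (ω : Ω)
    (n : Fin N) : ℂ :=
  star (h m n ω) / (√(∑ k, ‖h m k ω‖ ^ 2) : ℝ)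

/-- The received SNR at port `m`, `γ_m = P |w_m h_m|² / η₀²`. -/
def portSNR {Ω : Type*} {M N : ℕ} (P η₀ : ℝ) (h : Fin M → Fin N → Ω → ℂ) (m : Fin M) (ω : Ω) : ℝ :=
  P * ‖∑ n, mrtPrecoder h m ω n * h m n ω‖ ^ 2 / η₀ ^ 2

/-- The SNR of the selected port, `γ_FAS = max {γ_1, …, γ_M}`. -/
def fasSNR {Ω : Type*} {M N : ℕ} (P η₀ : ℝ) (h : Fin M → Fin N → Ω → ℂ) (ω : Ω) : ℝ :=
  ⨆ m, portSNR P η₀ h m ω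

/-- The average single-branch SNR of the branch `(m, n)`, `P E|h_{mn}|² / η₀²`. -/
def averageSNR {Ω : Type*} [MeasurableSpace Ω] (μ : Measure Ω) {M N : ℕ} (P η₀ : ℝ)
    (h : Fin M → Fin N → Ω → ℂ) (m : Fin M) (n : Fin N) : ℝ :=
  P * (∫ ω, ‖h m n ω‖ ^ 2 ∂μ) / η₀ ^ 2

/-- The outage probability in terms of the precoding gain, `Pr (X_FAS < γ_th)`. -/
def outageProb {Ω : Type*} [MeasurableSpace Ω] (μ : Measure Ω) {M N : ℕ}
    (h : Fin M → Fin N → Ω → ℂ) (γth : ℝ) : ℝ :=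
  μ.real {ω | fasGain h ω < γth}

/-- The outage probability in terms of the SNR normalized by the average SNR `γbar`,
`Pr (γ_FAS / γbar < γ_th)`. -/
def outageProbSNR {Ω : Type*} [MeasurableSpace Ω] (μ : Measure Ω) {M N : ℕ} (P η₀ : ℝ)
    (h : Fin M → Fin N → Ω → ℂ) (γbar γth : ℝ) : ℝ :=
  μ.real {ω | fasSNR P η₀ h ω / γbar < γth}

end

/-! Condition on the Gaussian row `u` of the reference port. Its own gain is `σ²‖u‖²`, and port `m`
has gain `σ²‖√(1-ρ²) v_m + ρ u‖²` with the rows `v_m` independent of each other and of `u`. Given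
`u`, outage at port `m` therefore puts `v_m` in a ball of fixed radius whose centre depends on `u`.

Centring that ball only increases its Gaussian measure (`halfGaussian_real_sum_sq_add_lt_le`), so
the conditional probability is at most an Erlang distribution function at `t/(σ²(1-ρ²))`, itself at
most the exponential one (`lowerIncompleteGamma_div_factorial_le`). This bound is uniform in `u`, so
integrating over `u` (`pi_fin_succ_apply_le`) leaves its `(M-1)`-th power times the Erlang
probability of outage at the reference port. The factor 2 in the exponent is slack.

For the SNR form, maximum-ratio transmission turns the SNR into a multiple of the precoding gain,
and every branch has mean power `σ²`, so normalizing replaces the threshold by `γth σ²`. -/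

/-! ### Gaussian measure of balls -/

/-- The law of a vector of independent centred Gaussian variables of variance `1/2`. -/
noncomputable abbrev halfGaussian (ι : Type*) [Fintype ι] : Measure (ι → ℝ) :=
  Measure.pi fun _ => gaussianReal 0 (1 / 2)

/-- The Lebesgue density of `halfGaussian`. -/
noncomputable def halfGaussianDensity {ι : Type*} [Fintype ι] (z : ι → ℝ) : ℝ :=
  ((√Real.pi)⁻¹) ^ Fintype.card ι * Real.exp (-∑ i, z i ^ 2)

lemma halfGaussianDensity_eq_prod {ι : Type*} [Fintype ι] (z : ι → ℝ) :
    halfGaussianDensity z = ∏ i, gaussianPDFReal 0 (1 / 2) (z i) := by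
  have h : 2 * Real.pi * ((1 / 2 : ℝ≥0) : ℝ) = Real.pi := by push_cast; ring
  have h' : 2 * ((1 / 2 : ℝ≥0) : ℝ) = 1 := by push_cast; ring
  simp only [halfGaussianDensity, gaussianPDFReal, h, h', Finset.prod_mul_distrib, ← Real.exp_sum,
    Finset.sum_neg_distrib, Finset.prod_const, Finset.card_univ, sub_zero, div_one]

lemma halfGaussianDensity_nonneg {ι : Type*} [Fintype ι] (z : ι → ℝ) :
    0 ≤ halfGaussianDensity z := by
  unfold halfGaussianDensity; positivity

lemma integrable_halfGaussianDensity (ι : Type*) [Fintype ι] :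
    Integrable (halfGaussianDensity : (ι → ℝ) → ℝ) := by
  have : (halfGaussianDensity : (ι → ℝ) → ℝ) =
      fun z => ∏ i, gaussianPDFReal 0 (1 / 2) (z i) := funext halfGaussianDensity_eq_prod
  rw [this]
  exact Integrable.fintype_prod fun _ => integrable_gaussianPDFReal 0 (1 / 2)

lemma halfGaussian_eq_withDensity (ι : Type*) [Fintype ι] :
    halfGaussian ι = volume.withDensity fun z => ENNReal.ofReal (halfGaussianDensity z) := by
  refine Measure.pi_eq fun s hs => ?_
  have hv : (1 / 2 : ℝ≥0) ≠ 0 := by norm_num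
  rw [withDensity_apply _ (MeasurableSet.univ_pi hs),
    ← ofReal_integral_eq_lintegral_ofReal (integrable_halfGaussianDensity ι).integrableOn
      (ae_of_all _ halfGaussianDensity_nonneg), volume_pi, Measure.restrict_pi_pi]
  simp_rw [halfGaussianDensity_eq_prod]
  rw [integral_fintype_prod_eq_prod (𝕜 := ℝ) (fun _ : ι => gaussianPDFReal 0 (1 / 2)),
    ENNReal.ofReal_prod_of_nonneg
      fun i _ => integral_nonneg fun x => gaussianPDFReal_nonneg _ _ _]
  exact Finset.prod_congr rfl fun i _ => (gaussianReal_apply_eq_integral 0 hv (s i)).symm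

lemma halfGaussian_real_eq_setIntegral {ι : Type*} [Fintype ι] {s : Set (ι → ℝ)}
    (hs : MeasurableSet s) : (halfGaussian ι).real s = ∫ z in s, halfGaussianDensity z := by
  rw [measureReal_def, halfGaussian_eq_withDensity, withDensity_apply _ hs,
    ← ofReal_integral_eq_lintegral_ofReal (integrable_halfGaussianDensity ι).integrableOn
      (ae_of_all _ halfGaussianDensity_nonneg),
    ENNReal.toReal_ofReal (integral_nonneg halfGaussianDensity_nonneg)]

lemma measurableSet_sum_sq_lt {ι : Type*} [Fintype ι] (a : ℝ) (b : ι → ℝ) (t : ℝ) :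
    MeasurableSet {z : ι → ℝ | ∑ i, (a * z i + b i) ^ 2 < t} :=
  measurableSet_lt (by fun_prop) measurable_const

lemma lowerIncompleteGamma_natCast {N : ℕ} (hN : 0 < N) (t : ℝ) :
    lowerIncompleteGamma N t = ∫ s in (0 : ℝ)..t, s ^ (N - 1) * Real.exp (-s) := by
  unfold lowerIncompleteGamma
  congr 1
  ext s
  rw [← Nat.cast_pred hN, Real.rpow_natCast]

/-- The squared norm of a Gaussian vector of even dimension has an Erlang distribution. -/
lemma halfGaussian_real_sum_sq_lt {ι : Type*} [Fintype ι] {N : ℕ} (hN : 0 < N)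
    (hι : Fintype.card ι = 2 * N) {t : ℝ} (ht : 0 ≤ t) :
    (halfGaussian ι).real {z | ∑ i, z i ^ 2 < t} =
      lowerIncompleteGamma N t / ((N - 1).factorial : ℝ) := by
  classical
  have hms : MeasurableSet {z : ι → ℝ | ∑ i, z i ^ 2 < t} :=
    measurableSet_lt (by fun_prop) measurable_const
  set f : ℝ → ℝ := fun r => if r ^ 2 < t then ((√Real.pi)⁻¹) ^ (2 * N) * Real.exp (-r ^ 2) else 0
    with hf
  have : Nonempty ι := Fintype.card_pos_iff.mp (by omega)
  have hdim : Module.finrank ℝ (EuclideanSpace ℝ ι) = 2 * N := by simp [hι]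
  have h1 : (halfGaussian ι).real {z | ∑ i, z i ^ 2 < t} =
      ∫ w : EuclideanSpace ℝ ι, f ‖w‖ := by
    rw [halfGaussian_real_eq_setIntegral hms, ← integral_indicator hms,
      ← (PiLp.volume_preserving_ofLp ι).integral_comp
        (MeasurableEquiv.toLp 2 (ι → ℝ)).symm.measurableEmbedding]
    congr 1
    ext w
    simp only [hf, EuclideanSpace.norm_sq_eq, Real.norm_eq_abs, sq_abs, Set.indicator_apply,
      Set.mem_ofPred_eq, halfGaussianDensity, hι]
  have hball : volume.real (Metric.ball (0 : EuclideanSpace ℝ ι) 1) =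
      Real.pi ^ N / N.factorial := by
    rw [measureReal_def, InnerProductSpace.volume_ball_of_dim_even hdim]
    simp only [ENNReal.ofReal_one, one_pow, one_mul]
    exact ENNReal.toReal_ofReal (by positivity)
  set g : ℝ → ℝ := (Set.Iio t).indicator fun s => s ^ (N - 1) * Real.exp (-s) with hg
  have h2 : ∫ y in Set.Ioi (0 : ℝ), y ^ (2 * N - 1) • f y =
      (Real.pi ^ N)⁻¹ / 2 * ∫ s in Set.Ioi (0 : ℝ), g s := by
    -- Substitution `s = y²`: one factor `y` of `y^(2N-1)` supplies the Jacobian, the rest is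
    -- `s^(N-1)`.
    rw [← integral_comp_rpow_Ioi_of_pos (g := g) (p := 2) two_pos, ← integral_const_mul]
    refine setIntegral_congr_fun measurableSet_Ioi fun y _ => ?_
    have hpi : ((√Real.pi)⁻¹) ^ (2 * N) = (Real.pi ^ N)⁻¹ := by
      rw [pow_mul, inv_pow, Real.sq_sqrt Real.pi_pos.le, inv_pow]
    have hy : y ^ (2 * N - 1) = y * (y ^ 2) ^ (N - 1) := by
      rw [← pow_mul, ← pow_succ']; congr 1; omega
    have h21 : (2 : ℝ) - 1 = 1 := by norm_num
    simp only [hf, hg, Set.indicator_apply, Set.mem_Iio, Real.rpow_two, smul_eq_mul, hpi, h21,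
      Real.rpow_one, hy]
    split_ifs <;> ring
  have h3 : ∫ s in Set.Ioi (0 : ℝ), g s = lowerIncompleteGamma N t := by
    rw [lowerIncompleteGamma_natCast hN, intervalIntegral.integral_of_le ht,
      integral_Ioc_eq_integral_Ioo, hg, setIntegral_indicator measurableSet_Iio]
    rfl
  -- Polar coordinates. The constants combine to `2N · π^N/N! · π^(-N)/2 = 1/(N-1)!`.
  rw [h1, integral_fun_norm_addHaar volume f, hdim, hball, h2, h3, nsmul_eq_mul,
    smul_eq_mul, ← Nat.mul_factorial_pred hN.ne']
  have := Real.pi_pos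
  have : (N : ℝ) ≠ 0 := by positivity
  push_cast
  field_simp

/-- Among the translates of a centred ball, the centred one has the largest Gaussian measure. -/
lemma halfGaussian_real_sum_sq_add_lt_le {ι : Type*} [Fintype ι] {a : ℝ} (ha : 0 < a)
    (b : ι → ℝ) (t : ℝ) :
    (halfGaussian ι).real {z | ∑ i, (a * z i + b i) ^ 2 < t} ≤
      (halfGaussian ι).real {z | ∑ i, z i ^ 2 < t / a ^ 2} := by
  set D : Set (ι → ℝ) := {z | ∑ i, (a * z i + b i) ^ 2 < t}
  set D₀ : Set (ι → ℝ) := {z | ∑ i, z i ^ 2 < t / a ^ 2}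
  have hD : MeasurableSet D := measurableSet_sum_sq_lt a b t
  have hD₀ : MeasurableSet D₀ := measurableSet_lt (by fun_prop) measurable_const
  -- `c` is the density at squared radius `t / a²`. It separates the values of the density inside
  -- `D₀` from those outside, so trading `D \ D₀` for `D₀ \ D`, of equal volume, cannot decrease the
  -- Gaussian measure.
  set c : ℝ := ((√Real.pi)⁻¹) ^ Fintype.card ι * Real.exp (-(t / a ^ 2))
  have hc : 0 < c := by positivity
  have hpre : D = (fun z => z + fun i => b i / a) ⁻¹' D₀ := by
    ext z
    have : ∑ i, (a * z i + b i) ^ 2 = (∑ i, (z i + b i / a) ^ 2) * a ^ 2 := by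
      rw [Finset.sum_mul]
      exact Finset.sum_congr rfl fun i _ => by field_simp
    simp [D, D₀, this, lt_div_iff₀ (pow_pos ha 2)]
  have hvol : volume D = volume D₀ := by rw [hpre, measure_preimage_add_right]
  have hD₀c : ∀ z ∈ D₀, c ≤ halfGaussianDensity z := fun z hz => by
    have hz : ∑ i, z i ^ 2 < t / a ^ 2 := hz
    unfold halfGaussianDensity c; gcongr
  have hDc : ∀ z ∉ D₀, halfGaussianDensity z ≤ c := fun z hz => by
    have hz : t / a ^ 2 ≤ ∑ i, z i ^ 2 := not_lt.mp hz
    unfold halfGaussianDensity c; gcongr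
  have happ : ∀ s, MeasurableSet s →
      halfGaussian ι s = ∫⁻ z in s, ENNReal.ofReal (halfGaussianDensity z) := fun s hs => by
    rw [halfGaussian_eq_withDensity, withDensity_apply _ hs]
  have hlow : ∀ s ⊆ D₀, MeasurableSet s → ENNReal.ofReal c * volume s ≤ halfGaussian ι s :=
    fun s hs hms => by
      rw [happ s hms, ← setLIntegral_const]
      exact setLIntegral_mono' hms fun z hz => ENNReal.ofReal_le_ofReal (hD₀c z (hs hz))
  -- Finiteness is needed to cancel the volume of `D ∩ D₀` below; it follows from `c · volume D₀ ≤
  -- 1`.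
  have hfin : volume D₀ ≠ ⊤ := fun h => by
    have := hlow D₀ subset_rfl hD₀
    rw [h, ENNReal.mul_top (by simpa using hc), top_le_iff] at this
    exact measure_ne_top _ _ this
  have hdiff : volume (D \ D₀) = volume (D₀ \ D) := by
    have h1 := measure_sdiff_add_inter (μ := volume) D hD₀
    have h2 := measure_sdiff_add_inter (μ := volume) D₀ hD
    rw [hvol, ← h2, Set.inter_comm D₀ D] at h1
    exact (ENNReal.add_left_inj (measure_ne_top_of_subset Set.inter_subset_right hfin)).mp h1
  refine ENNReal.toReal_mono (measure_ne_top _ _) ?_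
  rw [← measure_sdiff_add_inter D hD₀, ← measure_sdiff_add_inter D₀ hD, Set.inter_comm D₀ D]
  gcongr ?_ + _
  calc halfGaussian ι (D \ D₀) ≤ ENNReal.ofReal c * volume (D \ D₀) := by
        rw [happ _ (hD.diff hD₀), ← setLIntegral_const]
        exact setLIntegral_mono' (hD.diff hD₀) fun z hz => ENNReal.ofReal_le_ofReal (hDc z hz.2)
    _ = ENNReal.ofReal c * volume (D₀ \ D) := by rw [hdiff]
    _ ≤ halfGaussian ι (D₀ \ D) := hlow _ Set.sdiff_subset (hD₀.diff hD)

/-! ### Incomplete gamma function -/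

lemma lowerIncompleteGamma_nonneg (s : ℝ) {x : ℝ} (hx : 0 ≤ x) : 0 ≤ lowerIncompleteGamma s x :=
  intervalIntegral.integral_nonneg hx fun _ ht =>
    mul_nonneg (Real.rpow_nonneg ht.1 _) (Real.exp_nonneg _)

lemma lowerIncompleteGamma_natCast_mono {N : ℕ} (hN : 0 < N) {x y : ℝ} (hx : 0 ≤ x) (hxy : x ≤ y) :
    lowerIncompleteGamma N x ≤ lowerIncompleteGamma N y := by
  rw [lowerIncompleteGamma_natCast hN, lowerIncompleteGamma_natCast hN]
  refine intervalIntegral.integral_mono_interval le_rfl hx hxy ?_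
    (Continuous.intervalIntegrable (by fun_prop) _ _)
  filter_upwards [ae_restrict_mem measurableSet_Ioc] with t ht
  exact mul_nonneg (pow_nonneg ht.1.le _) (Real.exp_nonneg _)

lemma integral_pow_succ_mul_exp_neg (N : ℕ) (t : ℝ) :
    ∫ s in (0 : ℝ)..t, s ^ (N + 1) * Real.exp (-s) =
      (N + 1) * (∫ s in (0 : ℝ)..t, s ^ N * Real.exp (-s)) - t ^ (N + 1) * Real.exp (-t) := by
  have := intervalIntegral.integral_mul_deriv_eq_deriv_mul (a := 0) (b := t)
    (u := fun s : ℝ => s ^ (N + 1)) (v := fun s : ℝ => -Real.exp (-s))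
    (u' := fun s : ℝ => ((N + 1 : ℕ) : ℝ) * s ^ N) (v' := fun s : ℝ => Real.exp (-s))
    (fun s _ => by simpa using hasDerivAt_pow (N + 1) s)
    (fun s _ => by simpa using (hasDerivAt_neg s).exp.fun_neg)
    (Continuous.intervalIntegrable (by fun_prop) _ _)
    (Continuous.intervalIntegrable (by fun_prop) _ _)
  rw [this, ← intervalIntegral.integral_const_mul]
  simp only [mul_neg, intervalIntegral.integral_neg]
  push_cast
  simp only [mul_assoc]
  simp
  ring

/-- Integration by parts shows that the left side decreases in `N`; at `N = 1` there is equality. -/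
lemma lowerIncompleteGamma_div_factorial_le {N : ℕ} (hN : 0 < N) {t : ℝ} (ht : 0 ≤ t) :
    lowerIncompleteGamma N t / ((N - 1).factorial : ℝ) ≤ 1 - Real.exp (-t) := by
  rw [lowerIncompleteGamma_natCast hN]
  induction N, hN using Nat.le_induction with
  | base => simp [intervalIntegral.integral_comp_neg fun s => Real.exp s]
  | succ n hn ih =>
    obtain ⟨k, rfl⟩ := Nat.exists_eq_add_of_le' hn
    refine le_trans ?_ ih
    simp only [Nat.add_sub_cancel]
    rw [integral_pow_succ_mul_exp_neg, Nat.factorial_succ, sub_div]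
    push_cast
    rw [mul_div_mul_left _ _ (by positivity)]
    exact sub_le_self _ (by positivity)

/-! ### Conditioning on the reference coordinate -/

/-- Fubini in coordinate `0`: the fibre over `u ∈ A` is a product of `K` copies of one section of
`B`, hence has measure at most `q ^ K`; the other fibres are empty. -/
lemma pi_fin_succ_apply_le {E : Type*} [MeasurableSpace E] (ν : Measure E) [IsProbabilityMeasure ν]
    (K : ℕ) {A : Set E} (hA : MeasurableSet A) {B : Set (E × E)} (hB : MeasurableSet B)
    {q : ENNReal} (hq : ∀ u, ν {v | (u, v) ∈ B} ≤ q) :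
    Measure.pi (fun _ : Fin (K + 1) => ν) {w | w 0 ∈ A ∧ ∀ j : Fin K, (w 0, w j.succ) ∈ B} ≤
      ν A * q ^ K := by
  set S : Set (E × (Fin K → E)) := {p | p.1 ∈ A ∧ ∀ j, (p.1, p.2 j) ∈ B} with hS
  have hSm : MeasurableSet S := by
    have : S = Prod.fst ⁻¹' A ∩ ⋂ j, (fun p : E × (Fin K → E) => (p.1, p.2 j)) ⁻¹' B := by
      ext; simp [hS]
    rw [this]
    exact (measurable_fst hA).inter
      (MeasurableSet.iInter fun j => hB.preimage (by fun_prop))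
  have hmp := measurePreserving_piFinSuccAbove (fun _ : Fin (K + 1) => ν) 0
  have hpre : {w : Fin (K + 1) → E | w 0 ∈ A ∧ ∀ j : Fin K, (w 0, w j.succ) ∈ B} =
      MeasurableEquiv.piFinSuccAbove (fun _ => E) 0 ⁻¹' S := by
    ext w; simp [hS, Fin.tail]
  rw [hpre, hmp.measure_preimage hSm.nullMeasurableSet, Measure.prod_apply hSm]
  calc ∫⁻ u, Measure.pi (fun _ : Fin K => ν) (Prod.mk u ⁻¹' S) ∂ν
      ≤ ∫⁻ u, A.indicator (fun _ => q ^ K) u ∂ν := by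
        refine lintegral_mono fun u => ?_
        by_cases hu : u ∈ A
        · have : Prod.mk u ⁻¹' S = Set.univ.pi fun _ : Fin K => {v | (u, v) ∈ B} := by
            ext; simp [hS, hu]
          rw [this, Measure.pi_pi, Set.indicator_of_mem hu, Finset.prod_const, Finset.card_univ,
            Fintype.card_fin]
          exact pow_le_pow_left' (hq u) K
        · have : Prod.mk u ⁻¹' S = ∅ := by ext; simp [hS, hu]
          simp [this]
    _ = ν A * q ^ K := by rw [lintegral_indicator_const hA, mul_comm]

/-! ### Pointwise identities for gains and SNR -/

section Pointwise

variable {Ω : Type*} {M N : ℕ} {x y : Fin M → Fin N → Ω → ℝ}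

/-- The real and imaginary parts of the Gaussian vectors driving the ports. -/
def noiseRow (x y : Fin M → Fin N → Ω → ℝ) (ω : Ω) (m : Fin M) (k : Fin N ⊕ Fin N) : ℝ :=
  Sum.elim (fun n => x m n ω) (fun n => y m n ω) k

lemma sq_norm_channel_of_eq_zero {hM : 0 < M} (σ ρ : ℝ) {m : Fin M} (hm : (m : ℕ) = 0)
    (n : Fin N) (ω : Ω) :
    ‖channel hM σ ρ x y m n ω‖ ^ 2 = σ ^ 2 * (x m n ω ^ 2 + y m n ω ^ 2) := by
  rw [channel, if_pos hm, Complex.sq_norm, Complex.normSq_mk]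
  ring

lemma sq_norm_channel_of_ne_zero {hM : 0 < M} (σ ρ : ℝ) {m : Fin M} (hm : (m : ℕ) ≠ 0)
    (n : Fin N) (ω : Ω) :
    ‖channel hM σ ρ x y m n ω‖ ^ 2 =
      σ ^ 2 * ((√(1 - ρ ^ 2) * x m n ω + ρ * x ⟨0, hM⟩ n ω) ^ 2 +
        (√(1 - ρ ^ 2) * y m n ω + ρ * y ⟨0, hM⟩ n ω) ^ 2) := by
  rw [channel, if_neg hm, Complex.sq_norm, Complex.normSq_mk]
  ring

lemma precodingGain_le_fasGain (h : Fin M → Fin N → Ω → ℂ) (m : Fin M) (ω : Ω) :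
    precodingGain h m ω ≤ fasGain h ω :=
  le_ciSup (f := fun m => precodingGain h m ω) (Set.finite_range _).bddAbove m

lemma one_sub_sq_pos {ρ : ℝ} (hρ : |ρ| < 1) : 0 < 1 - ρ ^ 2 := by
  have := (sq_lt_one_iff_abs_lt_one ρ).mpr hρ
  linarith

/-- With `G` the gain, the precoded channel is `G / √G = √G`. Since `0 / 0 = 0`, this persists when
the channel vector vanishes. -/
lemma norm_sum_mrtPrecoder_mul_sq (h : Fin M → Fin N → Ω → ℂ) (m : Fin M) (ω : Ω) :
    ‖∑ n, mrtPrecoder h m ω n * h m n ω‖ ^ 2 = precodingGain h m ω := by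
  have hG : 0 ≤ precodingGain h m ω := Finset.sum_nonneg fun _ _ => by positivity
  have hsum : ∑ n, mrtPrecoder h m ω n * h m n ω = (√(precodingGain h m ω) : ℝ) := by
    calc ∑ n, mrtPrecoder h m ω n * h m n ω
        = ((precodingGain h m ω / √(precodingGain h m ω) : ℝ) : ℂ) := by
          unfold mrtPrecoder precodingGain
          push_cast
          rw [Finset.sum_div]
          refine Finset.sum_congr rfl fun n _ => ?_
          rw [div_mul_eq_mul_div, ← Complex.conj_mul']
          rfl
      _ = _ := by rw [Real.div_sqrt]
  rw [hsum, Complex.norm_real, Real.norm_eq_abs, sq_abs, Real.sq_sqrt hG]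

lemma fasSNR_eq {P η₀ : ℝ} (hP : 0 ≤ P) (h : Fin M → Fin N → Ω → ℂ) (ω : Ω) :
    fasSNR P η₀ h ω = P / η₀ ^ 2 * fasGain h ω := by
  unfold fasSNR fasGain portSNR
  rw [Real.mul_iSup_of_nonneg (by positivity)]
  congr 1
  ext m
  rw [norm_sum_mrtPrecoder_mul_sq]
  ring

end Pointwise

/-! ### Outage bound and mean branch power -/

section Probability

variable {Ω : Type*} [MeasurableSpace Ω] {μ : Measure Ω} {M N : ℕ}
  {x y : Fin M → Fin N → Ω → ℝ}

/-- The joint independence is reindexed by pairs (port, real or imaginary component) and then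
curried, so that the rows become independent Gaussian vectors of dimension `2N`. -/
lemma IsChannelNoise.hasLaw_noiseRow (h : IsChannelNoise μ x y) :
    HasLaw (noiseRow x y) (Measure.pi fun _ : Fin M => halfGaussian (Fin N ⊕ Fin N)) μ := by
  have hinj : Function.Injective fun p : Fin M × (Fin N ⊕ Fin N) =>
      (Sum.map (fun n => (p.1, n)) (fun n => (p.1, n)) p.2 :
        (Fin M × Fin N) ⊕ (Fin M × Fin N)) := by
    rintro ⟨m, n | n⟩ ⟨m', n' | n'⟩ h <;> simp_all
  have hlaw := (h.indep.precomp hinj).hasLaw_pi (μ := fun _ => gaussianReal 0 (1 / 2)) (by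
    rintro ⟨m, n | n⟩
    · exact h.law_x m n
    · exact h.law_y m n)
  have hcurry : HasLaw (MeasurableEquiv.curry (Fin M) (Fin N ⊕ Fin N) ℝ)
      (Measure.pi fun _ : Fin M => halfGaussian (Fin N ⊕ Fin N))
      (Measure.pi fun _ : Fin M × (Fin N ⊕ Fin N) => gaussianReal 0 (1 / 2)) := by
    refine ⟨by fun_prop, ?_⟩
    simpa only [Measure.infinitePi_eq_pi] using Measure.infinitePi_map_curry (X := ℝ)
      fun (_ : Fin M) (_ : Fin N ⊕ Fin N) => gaussianReal 0 (1 / 2)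
  convert! hcurry.comp hlaw using 1
  ext ω m k
  rcases k with n | n <;> rfl

lemma outageProb_channel_le [IsProbabilityMeasure μ] (hM : 0 < M) (hN : 0 < N) {σ ρ : ℝ}
    (hσ : 0 < σ) (hρ : |ρ| < 1) (hxy : IsChannelNoise μ x y) {t : ℝ} (ht : 0 ≤ t) :
    outageProb μ (channel hM σ ρ x y) t ≤
      lowerIncompleteGamma N (t / σ ^ 2) / ((N - 1).factorial : ℝ) *
        (1 - Real.exp (-(2 * t / (σ ^ 2 * (1 - ρ ^ 2))))) ^ (M - 1) := by
  obtain ⟨K, rfl⟩ := Nat.exists_eq_add_of_le' hM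
  have hρ' := one_sub_sq_pos hρ
  set ν := halfGaussian (Fin N ⊕ Fin N)
  set a := √(1 - ρ ^ 2)
  have ha : 0 < a := Real.sqrt_pos.mpr hρ'
  have ha2 : a ^ 2 = 1 - ρ ^ 2 := Real.sq_sqrt hρ'.le
  set s := t / σ ^ 2 with hs
  have hs0 : 0 ≤ s := by positivity
  have hcard : Fintype.card (Fin N ⊕ Fin N) = 2 * N := by simp; ring
  set A : Set (Fin N ⊕ Fin N → ℝ) := {u | ∑ k, u k ^ 2 < s} with hA
  set B : Set ((Fin N ⊕ Fin N → ℝ) × (Fin N ⊕ Fin N → ℝ)) :=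
    {p | ∑ k, (a * p.2 k + ρ * p.1 k) ^ 2 < s} with hB
  have hAm : MeasurableSet A := measurableSet_lt (by fun_prop) measurable_const
  have hBm : MeasurableSet B := measurableSet_lt (by fun_prop) measurable_const
  set q := 1 - Real.exp (-(2 * t / (σ ^ 2 * (1 - ρ ^ 2))))
  have hq0 : 0 ≤ q := sub_nonneg.mpr (Real.exp_le_one_iff.mpr (neg_nonpos.mpr (by positivity)))
  have hq : ∀ u, ν {v | (u, v) ∈ B} ≤ ENNReal.ofReal q := fun u => by
    rw [← ofReal_measureReal (μ := ν)]
    refine ENNReal.ofReal_le_ofReal ?_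
    calc ν.real {v | (u, v) ∈ B} ≤ ν.real {v | ∑ k, v k ^ 2 < s / a ^ 2} :=
          halfGaussian_real_sum_sq_add_lt_le ha (fun k => ρ * u k) s
      _ ≤ 1 - Real.exp (-(s / a ^ 2)) := by
          rw [halfGaussian_real_sum_sq_lt hN hcard (by positivity)]
          exact lowerIncompleteGamma_div_factorial_le hN (by positivity)
      -- Only here is the factor 2 introduced, by doubling a nonnegative exponent.
      _ ≤ q := by
          have h1 : s / a ^ 2 = t / (σ ^ 2 * (1 - ρ ^ 2)) := by rw [ha2, hs, div_div]
          have h2 : 0 ≤ t / (σ ^ 2 * (1 - ρ ^ 2)) := by positivity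
          refine sub_le_sub_left (Real.exp_le_exp.mpr (neg_le_neg ?_)) 1
          rw [h1, mul_div_assoc]
          linarith
  set S : Set (Fin (K + 1) → Fin N ⊕ Fin N → ℝ) :=
    {w | w 0 ∈ A ∧ ∀ j : Fin K, (w 0, w j.succ) ∈ B}
  have hSm : MeasurableSet S := by
    have : S = (fun w => w 0) ⁻¹' A ∩ ⋂ j : Fin K, (fun w => (w 0, w j.succ)) ⁻¹' B := by
      ext; simp [S]
    rw [this]
    exact (hAm.preimage (by fun_prop)).inter
      (MeasurableSet.iInter fun j => hBm.preimage (by fun_prop))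
  -- A maximum below `t` forces every gain below `t`; dividing by `σ²` gives the threshold `s`.
  have hsub : {ω | fasGain (channel hM σ ρ x y) ω < t} ⊆ noiseRow x y ⁻¹' S := fun ω hω => by
    have hgain m : precodingGain (channel hM σ ρ x y) m ω < t :=
      (precodingGain_le_fasGain _ m ω).trans_lt hω
    refine ⟨?_, fun j => ?_⟩
    · have := hgain 0
      simp only [precodingGain, sq_norm_channel_of_eq_zero σ ρ (Fin.val_zero _),
        ← Finset.mul_sum] at this
      rw [mul_comm, ← lt_div_iff₀ (by positivity), Finset.sum_add_distrib] at this
      simpa [hA, noiseRow] using this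
    · have := hgain j.succ
      simp only [precodingGain, sq_norm_channel_of_ne_zero σ ρ (by simp : (j.succ : ℕ) ≠ 0),
        ← Finset.mul_sum] at this
      rw [mul_comm, ← lt_div_iff₀ (by positivity), Finset.sum_add_distrib] at this
      simpa [hB, noiseRow] using this
  have hmain : μ {ω | fasGain (channel hM σ ρ x y) ω < t} ≤ ν A * ENNReal.ofReal q ^ K := by
    refine (measure_mono hsub).trans ?_
    rw [← Measure.map_apply_of_aemeasurable hxy.hasLaw_noiseRow.aemeasurable hSm,
      hxy.hasLaw_noiseRow.map_eq]
    exact pi_fin_succ_apply_le ν K hAm hBm hq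
  have := ENNReal.toReal_mono (by finiteness) hmain
  rw [ENNReal.toReal_mul, ENNReal.toReal_pow, ENNReal.toReal_ofReal hq0] at this
  rw [← halfGaussian_real_sum_sq_lt hN hcard hs0]
  exact this

lemma integral_sq_of_hasLaw_gaussianReal {X : Ω → ℝ}
    (hX : HasLaw X (gaussianReal 0 (1 / 2)) μ) : ∫ ω, X ω ^ 2 ∂μ = 1 / 2 := by
  have h1 : ∫ z, z ^ 2 ∂gaussianReal 0 (1 / 2) = 1 / 2 := by
    have := variance_fun_id_gaussianReal (μ := 0) (v := 1 / 2)
    rw [variance_of_integral_eq_zero (by fun_prop) (by simp)] at this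
    simpa using this
  rw [← h1]
  exact hX.integral_comp (f := fun z : ℝ => z ^ 2) (by fun_prop)

lemma memLp_two_of_hasLaw_gaussianReal {X : Ω → ℝ}
    (hX : HasLaw X (gaussianReal 0 (1 / 2)) μ) : MemLp X 2 μ := by
  have := memLp_id_gaussianReal (μ := 0) (v := 1 / 2) 2
  rw [← hX.map_eq] at this
  exact this.comp_of_map hX.aemeasurable

lemma integral_eq_zero_of_hasLaw_gaussianReal {X : Ω → ℝ}
    (hX : HasLaw X (gaussianReal 0 (1 / 2)) μ) : ∫ ω, X ω ∂μ = 0 := by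
  rw [hX.integral_eq]; simp

lemma integrable_sq_add_of_hasLaw_gaussianReal {X Y : Ω → ℝ}
    (hX : HasLaw X (gaussianReal 0 (1 / 2)) μ) (hY : HasLaw Y (gaussianReal 0 (1 / 2)) μ)
    (a b : ℝ) : Integrable (fun ω => (a * X ω + b * Y ω) ^ 2) μ :=
  (((memLp_two_of_hasLaw_gaussianReal hX).const_mul a).add
    ((memLp_two_of_hasLaw_gaussianReal hY).const_mul b)).integrable_sq

lemma integral_sq_add_of_indepFun {X Y : Ω → ℝ}
    (hX : HasLaw X (gaussianReal 0 (1 / 2)) μ) (hY : HasLaw Y (gaussianReal 0 (1 / 2)) μ)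
    (hXY : IndepFun X Y μ) (a b : ℝ) :
    ∫ ω, (a * X ω + b * Y ω) ^ 2 ∂μ = (a ^ 2 + b ^ 2) / 2 := by
  have hX2 := memLp_two_of_hasLaw_gaussianReal hX
  have hY2 := memLp_two_of_hasLaw_gaussianReal hY
  have hXYi : Integrable (fun ω => X ω * Y ω) μ := hX2.integrable_mul hY2
  have h0 : ∫ ω, X ω * Y ω ∂μ = 0 := by
    rw [hXY.integral_fun_mul_eq_mul_integral hX2.aestronglyMeasurable hY2.aestronglyMeasurable,
      integral_eq_zero_of_hasLaw_gaussianReal hX, zero_mul]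
  calc ∫ ω, (a * X ω + b * Y ω) ^ 2 ∂μ
      = ∫ ω, (a ^ 2 * X ω ^ 2 + b ^ 2 * Y ω ^ 2 + 2 * a * b * (X ω * Y ω)) ∂μ := by
        congr 1; ext ω; ring
    _ = (a ^ 2 + b ^ 2) / 2 := by
        have hsq : Integrable (fun ω => a ^ 2 * X ω ^ 2 + b ^ 2 * Y ω ^ 2) μ :=
          (hX2.integrable_sq.const_mul _).add (hY2.integrable_sq.const_mul _)
        rw [integral_add hsq (hXYi.const_mul _), integral_add (hX2.integrable_sq.const_mul _)
          (hY2.integrable_sq.const_mul _)]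
        simp only [integral_const_mul, h0, integral_sq_of_hasLaw_gaussianReal hX,
          integral_sq_of_hasLaw_gaussianReal hY]
        ring

/-- Independence kills the cross terms and `(1-ρ²) + ρ² = 1`, so the mean power does not depend on
the branch. -/
lemma integral_sq_norm_channel (hM : 0 < M) (σ : ℝ) {ρ : ℝ} (hρ : |ρ| < 1)
    (hxy : IsChannelNoise μ x y) (m : Fin M) (n : Fin N) :
    ∫ ω, ‖channel hM σ ρ x y m n ω‖ ^ 2 ∂μ = σ ^ 2 := by
  by_cases hm : (m : ℕ) = 0
  · simp_rw [sq_norm_channel_of_eq_zero σ ρ hm]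
    rw [integral_const_mul,
      integral_add (memLp_two_of_hasLaw_gaussianReal (hxy.law_x m n)).integrable_sq
        (memLp_two_of_hasLaw_gaussianReal (hxy.law_y m n)).integrable_sq,
      integral_sq_of_hasLaw_gaussianReal (hxy.law_x m n),
      integral_sq_of_hasLaw_gaussianReal (hxy.law_y m n)]
    ring
  · have hne : m ≠ ⟨0, hM⟩ := fun h => hm (congrArg Fin.val h)
    have hindx : IndepFun (x m n) (x ⟨0, hM⟩ n) μ :=
      hxy.indep.indepFun (i := Sum.inl (m, n)) (j := Sum.inl (⟨0, hM⟩, n)) (by simpa using hne)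
    have hindy : IndepFun (y m n) (y ⟨0, hM⟩ n) μ :=
      hxy.indep.indepFun (i := Sum.inr (m, n)) (j := Sum.inr (⟨0, hM⟩, n)) (by simpa using hne)
    simp_rw [sq_norm_channel_of_ne_zero σ ρ hm]
    rw [integral_const_mul,
      integral_add (integrable_sq_add_of_hasLaw_gaussianReal (hxy.law_x m n) (hxy.law_x _ n) _ _)
        (integrable_sq_add_of_hasLaw_gaussianReal (hxy.law_y m n) (hxy.law_y _ n) _ _),
      integral_sq_add_of_indepFun (hxy.law_x m n) (hxy.law_x _ n) hindx,
      integral_sq_add_of_indepFun (hxy.law_y m n) (hxy.law_y _ n) hindy,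
      Real.sq_sqrt (one_sub_sq_pos hρ).le]
    ring

lemma outageProbSNR_channel_eq (hM : 0 < M) {σ ρ : ℝ} (hσ : 0 < σ) (hρ : |ρ| < 1)
    {P η₀ : ℝ} (hP : 0 < P) (hη₀ : 0 < η₀) (hxy : IsChannelNoise μ x y) (m : Fin M) (n : Fin N)
    (t : ℝ) :
    outageProbSNR μ P η₀ (channel hM σ ρ x y)
        (averageSNR μ P η₀ (channel hM σ ρ x y) m n) t =
      outageProb μ (channel hM σ ρ x y) (t * σ ^ 2) := by
  unfold outageProbSNR outageProb
  congr 1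
  ext ω
  have : P / η₀ ^ 2 * fasGain (channel hM σ ρ x y) ω / (P * σ ^ 2 / η₀ ^ 2) =
      fasGain (channel hM σ ρ x y) ω / σ ^ 2 := by field_simp
  simp only [averageSNR, integral_sq_norm_channel hM σ hρ hxy, fasSNR_eq hP.le, Set.mem_ofPred_eq,
    this]
  exact div_lt_iff₀ (by positivity)

end Probability

theorem corollary1 {Ω : Type*} [MeasurableSpace Ω] (μ : Measure Ω) [IsProbabilityMeasure μ]
    {M N : ℕ} (hM : 0 < M) (hN : 0 < N)
    (σ ρ : ℝ) (hσ : 0 < σ) (hρ : |ρ| < 1)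
    (P η₀ : ℝ) (hP : 0 < P) (hη₀ : 0 < η₀)
    (x y : Fin M → Fin N → Ω → ℝ) (hxy : IsChannelNoise μ x y)
    (γth : ℝ) (hγth : 0 ≤ γth) :
    (outageProb μ (channel hM σ ρ x y) γth ≤
      lowerIncompleteGamma N (γth / σ ^ 2) / ((N - 1).factorial : ℝ) *
        (1 - Real.exp (-(2 * γth / (σ ^ 2 * (1 - ρ ^ 2))))) ^ (M - 1)) ∧
    (1 ≤ σ ^ 2 →
      outageProb μ (channel hM σ ρ x y) γth ≤
        lowerIncompleteGamma N γth / ((N - 1).factorial : ℝ) *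
          (1 - Real.exp (-(2 * γth / (σ ^ 2 * (1 - ρ ^ 2))))) ^ (M - 1)) ∧
    (∀ (m : Fin M) (n : Fin N),
      outageProbSNR μ P η₀ (channel hM σ ρ x y)
          (averageSNR μ P η₀ (channel hM σ ρ x y) m n) γth ≤
        lowerIncompleteGamma N γth / ((N - 1).factorial : ℝ) *
          (1 - Real.exp (-(2 * γth / (1 - ρ ^ 2)))) ^ (M - 1)) := by
  have hρ' := one_sub_sq_pos hρ
  refine ⟨outageProb_channel_le hM hN hσ hρ hxy hγth, fun hσ1 => ?_, fun m n => ?_⟩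
  · refine (outageProb_channel_le hM hN hσ hρ hxy hγth).trans ?_
    have hq : 0 ≤ 1 - Real.exp (-(2 * γth / (σ ^ 2 * (1 - ρ ^ 2)))) :=
      sub_nonneg.mpr (Real.exp_le_one_iff.mpr (neg_nonpos.mpr (by positivity)))
    have hle : lowerIncompleteGamma N (γth / σ ^ 2) ≤ lowerIncompleteGamma N γth :=
      lowerIncompleteGamma_natCast_mono hN (by positivity) (div_le_self hγth hσ1)
    gcongr
  · rw [outageProbSNR_channel_eq hM hσ hρ hP hη₀ hxy]
    refine (outageProb_channel_le hM hN hσ hρ hxy (by positivity)).trans_eq ?_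
    have h1 : γth * σ ^ 2 / σ ^ 2 = γth := by field_simp
    have h2 : 2 * (γth * σ ^ 2) / (σ ^ 2 * (1 - ρ ^ 2)) = 2 * γth / (1 - ρ ^ 2) := by
      field_simp
    rw [h1, h2]
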